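/- There is a universal constant $C>0$ such that the following holds. Let $n$ be a nonnegative integer and let $X=(X_1,\ldots,X_n)$ be a random vector in $\mathbb{R}^n$ which is symmetric ($-X$ has the same distribution as $X$) and has a log-concave density $g$, i.e. $g=e^{-h}$ for some convex function $h\colon\mathbb{R}^n\to(-\infty,\infty]$. Then for every real $p\geq n$ with $p>0$ and every $a=(a_1,\ldots,a_n)\in\mathbb{R}^n$, \[ \frac1C\,\|a\|_{K_p^\circ}\;\leq\;\Big(\mathbb{E}\Big|\sum_{i=1}^n a_iX_i\Big|^p\Big)^{1/p}\;\leq\; C\,\|a\|_{K_p^\circ}, \] where \[ K_p=\{x\in\mathbb{R}^n\colon g(x)\geq e^{-p}g(0)\},\qquad \|a\|_{K_p^\circ}=\sup\Big\{\sum_{i=1}^n a_ix_i\colon x\in K_p\Big\}, \] and both the $p$-th moment and the supremum are finite. -/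

import Mathlib

open MeasureTheory

/-- `g : ℝⁿ → [0, ∞]` is log-concave: it is of the form `g = e^{-h}` with
`h : ℝⁿ → (-∞, ∞]` convex. (In `EReal`, `c * ⊤ = ⊤` for `c > 0`, and `⊤ + t = ⊤` for `t ≠ ⊥`,
so the convexity inequality has its usual meaning for functions with values in `(-∞, ∞]`;
as `h` avoids `⊥`, `g` is finite everywhere.) -/
def IsLogConcave {n : ℕ} (g : (Fin n → ℝ) → ENNReal) : Prop :=
  ∃ h : (Fin n → ℝ) → EReal,
    (∀ x, h x ≠ ⊥) ∧
    (∀ (x y : Fin n → ℝ) (a b : ℝ), 0 < a → 0 < b → a + b = 1 →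
      h (a • x + b • y) ≤ (a : EReal) * h x + (b : EReal) * h y) ∧
    ∀ x, g x = EReal.exp (-h x)

/-- The level set `K_p = {x : g(x) ≥ e^{-p} g(0)}`. -/
def levelSet {n : ℕ} (g : (Fin n → ℝ) → ENNReal) (p : ℝ) : Set (Fin n → ℝ) :=
  {x | ENNReal.ofReal (Real.exp (-p)) * g 0 ≤ g x}

/-- The set of values `∑ aᵢ xᵢ`, for `x ∈ K`. -/
def linearValues {n : ℕ} (a : Fin n → ℝ) (K : Set (Fin n → ℝ)) : Set ℝ :=
  (fun x : Fin n → ℝ => ∑ i, a i * x i) '' K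

/-- `‖a‖_{K°} = sup {∑ aᵢ xᵢ : x ∈ K}`. -/
noncomputable def polarNorm {n : ℕ} (a : Fin n → ℝ) (K : Set (Fin n → ℝ)) : ℝ :=
  sSup (linearValues a K)

/-- The moment `‖Y‖_p = (E |Y|^p)^{1/p}` of a real random variable. -/
noncomputable def momentNorm {Ω : Type*} [MeasurableSpace Ω] (P : Measure Ω) (p : ℝ)
    (Y : Ω → ℝ) : ℝ :=
  (∫ ω, |Y ω| ^ p ∂P) ^ (1 / p)

open ENNReal

/-! Both bounds come from midpoint log-concavity of the density `G`, applied to `L x = ∑ aᵢ xᵢ`.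
Since `p ≥ n`, Jacobians `2 ^ n` are absorbed into `C ^ p`.

Lower bound (`measure_halfspace_ge`): for `x₀ ∈ K_p`, the map `y ↦ (x₀ + y) / 2` sends `{L ≥ 0}`, of
mass at least `1/2`, into `{L ≥ L x₀ / 2}`. It lowers the density by at most `e^{-p/2}`, because `G
y ≤ G 0`, and volume by `2 ^ n`; Markov's inequality concludes. As tails of `L` vanish, the same
estimate bounds `L` on `K_p`.

Upper bound (`le_exp_mul_half`, `lintegral_rpow_le`): if `L < s` on `K_p` and `L x = t s` with `t >
1`, then `x / t ∉ K_p`. Concavity along `[0, x]` gives `G x ≤ e^{-pt} G 0`, hence `G x ≤ e^{-pt/2} G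
(x / 2)`. The exponential absorbs `|L x| ^ p`, and `G (x / 2)` is integrable. -/

/-- Multiplicative log-concavity of a real-valued function. -/
def IsMulConcave {n : ℕ} (G : (Fin n → ℝ) → ℝ) : Prop :=
  ∀ (x y : Fin n → ℝ) (a b : ℝ), 0 < a → 0 < b → a + b = 1 →
    G x ^ a * G y ^ b ≤ G (a • x + b • y)

/-! ### Real-valued log-concave functions -/

theorem IsLogConcave.ne_top {n : ℕ} {g : (Fin n → ℝ) → ENNReal} (hg : IsLogConcave g)
    (x : Fin n → ℝ) : g x ≠ ⊤ := by
  obtain ⟨h, hbot, -, hgh⟩ := hg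
  rw [hgh, Ne, EReal.exp_eq_top_iff, EReal.neg_eq_top_iff]
  exact hbot x

theorem IsLogConcave.isMulConcave {n : ℕ} {g : (Fin n → ℝ) → ENNReal} (hg : IsLogConcave g) :
    IsMulConcave fun x => (g x).toReal := by
  obtain ⟨h, hbot, hconv, hgh⟩ := hg
  intro x y a b ha hb hab
  have key := hconv x y a b ha hb hab
  have hz : ∀ z, h z = ⊤ → (g z).toReal = 0 := fun z hz => by simp [hgh, hz]
  have hr : ∀ z (r : ℝ), h z = r → (g z).toReal = Real.exp (-r) := fun z r hz => by
    rw [hgh, hz, ← EReal.coe_neg, EReal.exp_coe, ENNReal.toReal_ofReal (Real.exp_pos _).le]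
  by_cases hx : h x = ⊤
  · simp only [hz x hx, Real.zero_rpow ha.ne', zero_mul]
    exact ENNReal.toReal_nonneg
  by_cases hy : h y = ⊤
  · simp only [hz y hy, Real.zero_rpow hb.ne', mul_zero]
    exact ENNReal.toReal_nonneg
  lift h x to ℝ using ⟨hx, hbot x⟩ with u hu
  lift h y to ℝ using ⟨hy, hbot y⟩ with v hv
  rw [← EReal.coe_mul, ← EReal.coe_mul, ← EReal.coe_add] at key
  have hw : h (a • x + b • y) ≠ ⊤ := fun e => by
    rw [e, top_le_iff] at key
    exact EReal.coe_ne_top (a * u + b * v) (by exact_mod_cast key)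
  lift h (a • x + b • y) to ℝ using ⟨hw, hbot _⟩ with w hw'
  have key' : w ≤ a * u + b * v := by exact_mod_cast key
  simp only [hr x u hu.symm, hr y v hv.symm, hr _ w hw'.symm, ← Real.exp_mul, ← Real.exp_add]
  exact Real.exp_le_exp.2 (by linarith)

namespace IsMulConcave

variable {n : ℕ} {G : (Fin n → ℝ) → ℝ}

theorem half (hG : IsMulConcave G) (h0 : ∀ x, 0 ≤ G x) {m A B : ℝ} (hB : 0 ≤ B)
    (hm : 0 ≤ m) {x y : Fin n → ℝ} (hx : A ≤ G x) (hy : B ≤ G y) (hAB : m ^ 2 ≤ A * B) :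
    m ≤ G ((1 / 2 : ℝ) • (x + y)) := by
  have h := hG x y (1 / 2) (1 / 2) (by norm_num) (by norm_num) (by norm_num)
  rw [← Real.mul_rpow (h0 x) (h0 y), ← Real.sqrt_eq_rpow, ← smul_add] at h
  refine (Real.le_sqrt hm ?_).2 (hAB.trans ?_) |>.trans h
  all_goals first | exact mul_nonneg (h0 x) (h0 y) | exact mul_le_mul hx hy hB (h0 x)

theorem convex_superlevel (hG : IsMulConcave G) {c : ℝ} (hc : 0 ≤ c) :
    Convex ℝ {x | c ≤ G x} := by
  rw [convex_iff_forall_pos]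
  intro x hx y hy a b ha hb hab
  rcases hc.eq_or_lt with rfl | hc
  · refine le_trans ?_ (hG x y a b ha hb hab)
    exact mul_nonneg (Real.rpow_nonneg hx _) (Real.rpow_nonneg hy _)
  · calc c = c ^ a * c ^ b := by rw [← Real.rpow_add hc, hab, Real.rpow_one]
      _ ≤ G x ^ a * G y ^ b := mul_le_mul (Real.rpow_le_rpow hc.le hx ha.le)
          (Real.rpow_le_rpow hc.le hy hb.le) (by positivity) (Real.rpow_nonneg (hc.le.trans hx) _)
      _ ≤ _ := hG x y a b ha hb hab

/-- Superlevel sets are convex, and convex sets are null-measurable. -/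
theorem aemeasurable (hG : IsMulConcave G) (h0 : ∀ x, 0 ≤ G x) :
    AEMeasurable G (volume : Measure (Fin n → ℝ)) := by
  apply NullMeasurable.aemeasurable
  have : @Measurable (NullMeasurableSpace (Fin n → ℝ) volume) ℝ _ _ G := by
    refine measurable_of_Ici fun c => ?_
    rcases le_total c 0 with hc | hc
    · convert MeasurableSet.univ
      exact Set.eq_univ_of_forall fun x => hc.trans (h0 x)
    · exact (hG.convex_superlevel hc).nullMeasurableSet volume
  exact fun s hs => this hs

end IsMulConcave

/-! ### Scaling and symmetry of densities -/

theorem lintegral_comp_smul_fin {n : ℕ} {r : ℝ} (hr : r ≠ 0) (f : (Fin n → ℝ) → ENNReal) :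
    ∫⁻ x, f (r • x) = ENNReal.ofReal |(r ^ n)⁻¹| * ∫⁻ x, f x := by
  have h := Measure.map_addHaar_smul (volume : Measure (Fin n → ℝ)) hr
  rw [Module.finrank_fin_fun] at h
  have e := (measurableEmbedding_const_smul₀ (α := Fin n → ℝ) hr).lintegral_map (μ := volume) f
  rw [h, lintegral_smul_measure] at e
  exact e.symm

theorem quasiMeasurePreserving_smul_fin {n : ℕ} {r : ℝ} (hr : r ≠ 0) :
    Measure.QuasiMeasurePreserving (fun x : Fin n → ℝ => r • x) volume volume := by
  refine ⟨measurable_const_smul r, ?_⟩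
  have h := Measure.map_addHaar_smul (volume : Measure (Fin n → ℝ)) hr
  exact h ▸ Measure.smul_absolutelyContinuous

/-- A symmetric law with density `G` has an even density, up to null sets. -/
theorem ae_even_of_map_neg {n : ℕ} {g : (Fin n → ℝ) → ENNReal}
    (hg : AEMeasurable g volume) (hfin : ∫⁻ x, g x ≠ ⊤)
    (hsymm : (volume.withDensity g).map (fun x => -x) = volume.withDensity g) :
    ∀ᵐ x, g (-x) = g x := by
  have mp : MeasurePreserving (fun x : Fin n → ℝ => -x) volume volume :=
    Measure.measurePreserving_neg _
  have hg' : AEMeasurable (fun x => g (-x)) volume := hg.comp_quasiMeasurePreserving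
    mp.quasiMeasurePreserving
  have emb : MeasurableEmbedding (fun x : Fin n → ℝ => -x) :=
    (MeasurableEquiv.neg (Fin n → ℝ)).measurableEmbedding
  have : volume.withDensity (fun x => g (-x)) = volume.withDensity g := by
    rw [← hsymm]
    ext s hs
    rw [Measure.map_apply measurable_neg hs, withDensity_apply _ hs,
      withDensity_apply _ (measurable_neg hs)]
    rw [← mp.setLIntegral_comp_preimage_emb emb]
    simp only [neg_neg]
  refine (withDensity_eq_iff hg' hg ?_).1 this
  rw [← setLIntegral_univ, ← withDensity_apply _ MeasurableSet.univ, this,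
    withDensity_apply _ MeasurableSet.univ, setLIntegral_univ]
  exact hfin

section Symmetric

variable {n : ℕ} {G : (Fin n → ℝ) → ℝ}

/-- The origin is the midpoint of `x` and `-x`. -/
theorem ae_le_zero_of_even (hG : IsMulConcave G) (h0 : ∀ x, 0 ≤ G x)
    (heven : ∀ᵐ x, G (-x) = G x) : ∀ᵐ x, G x ≤ G 0 := by
  filter_upwards [heven] with x hx
  simpa using hG.half h0 (h0 x) (h0 x) (x := x) (y := -x) le_rfl hx.ge (by rw [sq])

theorem zero_pos_of_lintegral_ne_zero (hint : ∫⁻ x, ENNReal.ofReal (G x) ≠ 0)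
    (hmax : ∀ᵐ x, G x ≤ G 0) : 0 < G 0 := by
  by_contra! h
  refine hint ((lintegral_congr_ae ?_).trans lintegral_zero)
  filter_upwards [hmax] with x hx
  exact ENNReal.ofReal_of_nonpos (hx.trans h)

/-- A half-space at half the height of a point of the level set carries a mass of order
`2⁻ⁿ e^{-p/2}`. -/
theorem measure_halfspace_ge (hG : IsMulConcave G) (h0 : ∀ x, 0 ≤ G x)
    (hmax : ∀ᵐ x, G x ≤ G 0) {L : (Fin n → ℝ) →L[ℝ] ℝ} {p : ℝ}
    {x₀ : Fin n → ℝ} (hx₀ : Real.exp (-p) * G 0 ≤ G x₀) :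
    ENNReal.ofReal (Real.exp (-(p / 2))) *
        volume.withDensity (fun x => ENNReal.ofReal (G x)) {x | 0 ≤ L x} ≤
      ENNReal.ofReal (2 ^ n) *
        volume.withDensity (fun x => ENNReal.ofReal (G x)) {x | L x₀ / 2 ≤ L x} := by
  have hm : ∀ c : ℝ, MeasurableSet {x | c ≤ L x} := fun c =>
    measurableSet_le measurable_const L.measurable
  rw [withDensity_apply _ (hm _), withDensity_apply _ (hm _), ← lintegral_indicator (hm _),
    ← lintegral_indicator (hm _), ← lintegral_const_mul' _ _ ENNReal.ofReal_ne_top]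
  have hsc := lintegral_comp_smul_fin (n := n) (r := 1 / 2) (by norm_num)
    ({x | L x₀ / 2 ≤ L x}.indicator fun x => ENNReal.ofReal (G x))
  have h2 : |((1 / 2 : ℝ) ^ n)⁻¹| = 2 ^ n := by
    rw [abs_of_pos (by positivity), one_div, inv_pow, inv_inv]
  rw [h2] at hsc
  -- Change of variables `x = (x₀ + y) / 2`, after which the integrands compare pointwise.
  rw [← hsc, ← lintegral_add_left_eq_self (fun x => _root_.Set.indicator _ _ ((1 / 2 : ℝ) • x)) x₀]
  refine lintegral_mono_ae ?_
  filter_upwards [hmax] with y hy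
  by_cases hLy : 0 ≤ L y
  · have hmem : (1 / 2 : ℝ) • (x₀ + y) ∈ {x | L x₀ / 2 ≤ L x} := by
      simp only [Set.mem_ofPred_eq, map_smul, map_add, smul_eq_mul]
      linarith
    rw [Set.indicator_of_mem (show y ∈ {x | 0 ≤ L x} from hLy), Set.indicator_of_mem hmem,
      ← ENNReal.ofReal_mul (Real.exp_pos _).le]
    refine ENNReal.ofReal_le_ofReal (hG.half h0 (h0 y)
      (mul_nonneg (Real.exp_pos _).le (h0 y)) hx₀ le_rfl ?_)
    have : Real.exp (-(p / 2)) ^ 2 = Real.exp (-p) := by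
      rw [← Real.exp_nat_mul]; congr 1; push_cast; ring
    rw [mul_pow, this, mul_assoc, sq]
    gcongr
    exact h0 y
  · rw [Set.indicator_of_notMem (show y ∉ {x | 0 ≤ L x} from hLy), mul_zero]
    exact zero_le

/-- Exponential decay of the density beyond the level set. -/
theorem le_exp_mul_half (hG : IsMulConcave G) (h0 : ∀ x, 0 ≤ G x)
    (hpos : 0 < G 0) {L : (Fin n → ℝ) →L[ℝ] ℝ} {p s : ℝ} (hs : 0 < s)
    (hK : ∀ x, Real.exp (-p) * G 0 ≤ G x → L x < s) {x : Fin n → ℝ} (hx : s < L x) :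
    G x ≤ Real.exp (-(p * (L x / s) / 2)) * G ((1 / 2 : ℝ) • x) := by
  rcases (h0 x).eq_or_lt with h | hGx
  · rw [← h]; exact mul_nonneg (Real.exp_pos _).le (h0 _)
  set t := L x / s with ht
  have ht1 : 1 < t := (one_lt_div hs).2 hx
  have ht0 : 0 < t := by linarith
  have hout : G (t⁻¹ • x) < Real.exp (-p) * G 0 := by
    by_contra! h
    have := hK _ h
    rw [map_smul, smul_eq_mul, ht, inv_div, div_mul_cancel₀ _ (hs.trans hx).ne'] at this
    exact this.false
  have hconc := hG x 0 t⁻¹ (1 - t⁻¹) (inv_pos.2 ht0) (sub_pos.2 (inv_lt_one_of_one_lt₀ ht1))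
    (by ring)
  rw [smul_zero, add_zero] at hconc
  have hlog := Real.log_lt_log (by positivity) (hconc.trans_lt hout)
  rw [Real.log_mul (by positivity) (by positivity), Real.log_rpow hGx, Real.log_rpow hpos,
    Real.log_mul (by positivity) hpos.ne', Real.log_exp] at hlog
  have hdec : Real.log (G x) ≤ -(p * t) + Real.log (G 0) := by
    have h1 : t⁻¹ * (Real.log (G x) - Real.log (G 0)) ≤ -p := by linarith
    rw [inv_mul_le_iff₀ ht0] at h1
    linarith
  have hdec' : G x ≤ Real.exp (-(p * t)) * G 0 := by
    rw [← Real.exp_log hGx]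
    refine (Real.exp_le_exp.2 hdec).trans_eq ?_
    rw [Real.exp_add, Real.exp_log hpos]
  -- By the decay just proved, `(e^{pt/2} G x)² ≤ G x * G 0`.
  have hhalf := hG.half h0 hpos.le (m := Real.exp (p * t / 2) * G x) (by positivity)
    (x := x) (y := 0) le_rfl le_rfl (by
      have h2 : Real.exp (p * t / 2) ^ 2 = Real.exp (p * t) := by
        rw [← Real.exp_nat_mul]; congr 1; push_cast; ring
      have h3 : Real.exp (p * t) * G x ≤ G 0 := by
        calc _ ≤ Real.exp (p * t) * (Real.exp (-(p * t)) * G 0) := by gcongr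
          _ = G 0 := by rw [← mul_assoc, ← Real.exp_add]; simp
      rw [mul_pow, h2, sq, ← mul_assoc, mul_comm (G x)]
      gcongr)
  rw [add_zero] at hhalf
  calc G x = Real.exp (-(p * t / 2)) * (Real.exp (p * t / 2) * G x) := by
        rw [← mul_assoc, ← Real.exp_add]; simp
    _ ≤ _ := by gcongr

/-- The `p`-th power of `v ≤ e^v` with `v = u / (2s)`. -/
theorem rpow_mul_exp_le {p s u : ℝ} (hp : 0 ≤ p) (hs : 0 < s) (hu : 0 ≤ u) :
    u ^ p * Real.exp (-(p * (u / s) / 2)) ≤ (2 * s) ^ p := by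
  have h1 : Real.exp (-(p * (u / s) / 2)) = Real.exp (-(u / s / 2)) ^ p := by
    rw [← Real.exp_mul]; congr 1; ring
  rw [h1, ← Real.mul_rpow hu (Real.exp_pos _).le]
  refine Real.rpow_le_rpow (by positivity) ?_ hp
  have h2 : u / s / 2 ≤ Real.exp (u / s / 2) := by linarith [Real.add_one_le_exp (u / s / 2)]
  rw [Real.exp_neg, ← div_eq_mul_inv, div_le_iff₀ (Real.exp_pos _)]
  calc u = 2 * s * (u / s / 2) := by field_simp
    _ ≤ _ := by gcongr

/-- The slab `|L| ≤ s` contributes at most `s ^ p`; each side beyond it at most `2 ^ n (2s) ^ p`. -/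
theorem lintegral_rpow_le (hG : IsMulConcave G) (h0 : ∀ x, 0 ≤ G x)
    (hint : ∫⁻ x, ENNReal.ofReal (G x) = 1)
    (heven : ∀ᵐ x, G (-x) = G x) (hpos : 0 < G 0) {L : (Fin n → ℝ) →L[ℝ] ℝ} {p s : ℝ}
    (hp : 1 ≤ p) (hnp : (n : ℝ) ≤ p) (hs : 0 < s)
    (hK : ∀ x, Real.exp (-p) * G 0 ≤ G x → L x < s) :
    ∫⁻ x, ENNReal.ofReal (|L x| ^ p) ∂(volume.withDensity fun x => ENNReal.ofReal (G x)) ≤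
      ENNReal.ofReal ((16 * s) ^ p) := by
  have hp0 : 0 ≤ p := by linarith
  have hmeas : AEMeasurable (fun x => ENNReal.ofReal (G x)) volume :=
    (hG.aemeasurable h0).ennreal_ofReal
  have hF : Measurable fun x => ENNReal.ofReal (|L x| ^ p) := by fun_prop
  rw [lintegral_withDensity_eq_lintegral_mul₀ hmeas hF.aemeasurable]
  have hpt : ∀ᵐ x, ((fun x => ENNReal.ofReal (G x)) * fun x => ENNReal.ofReal (|L x| ^ p)) x ≤
      ENNReal.ofReal (s ^ p) * ENNReal.ofReal (G x) +
        ENNReal.ofReal ((2 * s) ^ p) * ENNReal.ofReal (G ((1 / 2 : ℝ) • x)) +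
        ENNReal.ofReal ((2 * s) ^ p) * ENNReal.ofReal (G ((-(1 / 2) : ℝ) • x)) := by
    filter_upwards [heven] with x hx
    have aux : ∀ y, G y = G x → |L y| = |L x| → s < L y →
        ENNReal.ofReal (G x) * ENNReal.ofReal (|L x| ^ p) ≤
          ENNReal.ofReal ((2 * s) ^ p) * ENNReal.ofReal (G ((1 / 2 : ℝ) • y)) := by
      intro y hy hLy hsy
      have hd := le_exp_mul_half hG h0 hpos hs hK hsy
      have habs : |L x| = L y := by rw [← hLy, abs_of_pos (hs.trans hsy)]
      rw [← ENNReal.ofReal_mul (h0 x), ← ENNReal.ofReal_mul (by positivity), habs, ← hy]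
      refine ENNReal.ofReal_le_ofReal ?_
      have hLy0 : 0 ≤ L y := (hs.trans hsy).le
      calc G y * L y ^ p ≤ (Real.exp (-(p * (L y / s) / 2)) * G ((1 / 2 : ℝ) • y)) * L y ^ p := by
            gcongr
        _ = (L y ^ p * Real.exp (-(p * (L y / s) / 2))) * G ((1 / 2 : ℝ) • y) := by ring
        _ ≤ _ := mul_le_mul_of_nonneg_right (rpow_mul_exp_le hp0 hs hLy0) (h0 _)
    simp only [Pi.mul_apply]
    rcases le_or_gt |L x| s with h | h
    · rw [add_assoc]
      refine le_add_right ?_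
      rw [mul_comm]
      gcongr
    rcases lt_abs.1 h with h | h
    · exact (aux x rfl rfl h).trans (le_add_right (le_add_left le_rfl))
    · have := aux (-x) hx (by simp) (by simpa using h)
      rw [smul_neg, ← neg_smul] at this
      exact this.trans (le_add_left le_rfl)
  have hsm : ∀ r : ℝ, r ≠ 0 → AEMeasurable (fun x => ENNReal.ofReal (G (r • x))) volume :=
    fun r hr => hmeas.comp_quasiMeasurePreserving (quasiMeasurePreserving_smul_fin hr)
  refine (lintegral_mono_ae hpt).trans ?_
  rw [lintegral_add_right' _ ((hsm _ (by norm_num)).const_mul _),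
    lintegral_add_right' _ ((hsm _ (by norm_num)).const_mul _),
    lintegral_const_mul' _ _ ENNReal.ofReal_ne_top, lintegral_const_mul' _ _ ENNReal.ofReal_ne_top,
    lintegral_const_mul' _ _ ENNReal.ofReal_ne_top,
    lintegral_comp_smul_fin (r := 1 / 2) (by norm_num) fun x => ENNReal.ofReal (G x),
    lintegral_comp_smul_fin (r := -(1 / 2)) (by norm_num) fun x => ENNReal.ofReal (G x), hint]
  have h2 : |((1 / 2 : ℝ) ^ n)⁻¹| = 2 ^ n := by
    rw [abs_of_pos (by positivity), one_div, inv_pow, inv_inv]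
  have h3 : |((-(1 / 2) : ℝ) ^ n)⁻¹| = 2 ^ n := by
    rw [← h2, abs_inv, abs_inv, abs_pow, abs_pow, abs_neg]
  rw [h2, h3, mul_one, mul_one, ← ENNReal.ofReal_mul (by positivity),
    ← ENNReal.ofReal_add (by positivity) (by positivity),
    ← ENNReal.ofReal_add (by positivity) (by positivity)]
  refine ENNReal.ofReal_le_ofReal ?_
  have h4 : (2 : ℝ) ^ n ≤ 2 ^ p := by
    rw [← Real.rpow_natCast]; exact Real.rpow_le_rpow_of_exponent_le (by norm_num) hnp
  have h5 : (2 : ℝ) ≤ 2 ^ p := by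
    simpa using Real.rpow_le_rpow_of_exponent_le (x := 2) (by norm_num) hp
  have h6 : (16 * s) ^ p = (2 ^ p) ^ 3 * (2 * s) ^ p := by
    rw [← Real.rpow_natCast, ← Real.rpow_mul (by norm_num), mul_comm p, Real.rpow_mul (by norm_num),
      ← Real.mul_rpow (by positivity) (by positivity)]
    congr 1; norm_num; ring
  have h7 : s ^ p ≤ (2 * s) ^ p := Real.rpow_le_rpow hs.le (by linarith) hp0
  have h8 : (2 * s) ^ p * 2 ^ n ≤ (2 * s) ^ p * 2 ^ p := by gcongr
  have h9 : 1 + 2 * (2 : ℝ) ^ p ≤ (2 ^ p) ^ 3 := by nlinarith [mul_self_nonneg ((2 : ℝ) ^ p - 2)]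
  have hB : 0 ≤ (2 * s) ^ p := by positivity
  rw [h6]
  nlinarith [mul_le_mul_of_nonneg_right h9 hB]

end Symmetric

/-! ### Two-sided moment bounds for a symmetric law -/

section Symmetric

variable {n : ℕ} {G : (Fin n → ℝ) → ℝ}

theorem half_le_measure_nonneg {μ : Measure (Fin n → ℝ)} [IsProbabilityMeasure μ]
    (hsymm : μ.map (fun x => -x) = μ) (L : (Fin n → ℝ) →L[ℝ] ℝ) :
    1 / 2 ≤ μ {x | 0 ≤ L x} := by
  have hm : MeasurableSet {x | 0 ≤ L x} := measurableSet_le measurable_const L.measurable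
  have h1 : μ {x | L x ≤ 0} = μ {x | 0 ≤ L x} := by
    conv_rhs => rw [← hsymm, Measure.map_apply measurable_neg hm]
    congr 1
    ext x
    simp
  have h2 : (1 : ENNReal) ≤ μ {x | 0 ≤ L x} + μ {x | L x ≤ 0} := by
    rw [← measure_univ (μ := μ)]
    refine (measure_mono ?_).trans (measure_union_le _ _)
    intro x _
    exact le_total 0 (L x)
  rw [h1, ← two_mul] at h2
  exact ENNReal.div_le_of_le_mul (by rwa [mul_comm] at h2)

theorem exists_measure_halfspace_lt {μ : Measure (Fin n → ℝ)} [IsProbabilityMeasure μ]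
    (L : (Fin n → ℝ) →L[ℝ] ℝ) {ε : ENNReal} (hε : 0 < ε) : ∃ t : ℝ, μ {x | t ≤ L x} < ε := by
  have h := tendsto_measure_iInter_atTop (μ := μ) (s := fun t : ℝ => {x | t ≤ L x})
    (fun t => (measurableSet_le measurable_const L.measurable).nullMeasurableSet)
    (fun s t hst x hx => le_trans hst hx) ⟨0, measure_ne_top _ _⟩
  have he : ⋂ t : ℝ, {x | t ≤ L x} = ∅ := by
    refine Set.eq_empty_of_forall_notMem fun x hx => ?_
    have := Set.mem_iInter.1 hx (L x + 1)
    simp only [Set.mem_ofPred_eq] at this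
    linarith
  rw [he, measure_empty] at h
  exact (h.eventually_lt_const hε).exists

/-- The bounds on the level set and on the moments for the law `μ` with density `G`. -/
theorem moment_bounds (hG : IsMulConcave G) (h0 : ∀ x, 0 ≤ G x) {μ : Measure (Fin n → ℝ)}
    [IsProbabilityMeasure μ] (hμ : μ = volume.withDensity fun x => ENNReal.ofReal (G x))
    (hsymm : μ.map (fun x => -x) = μ) (L : (Fin n → ℝ) →L[ℝ] ℝ) {p : ℝ}
    (hp : 1 ≤ p) (hnp : (n : ℝ) ≤ p) :
    0 < G 0 ∧ BddAbove (L '' {x | Real.exp (-p) * G 0 ≤ G x}) ∧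
      (∀ x, 0 ≤ L x → Real.exp (-p) * G 0 ≤ G x →
        ENNReal.ofReal ((L x / 16) ^ p) ≤ ∫⁻ x, ENNReal.ofReal (|L x| ^ p) ∂μ) ∧
      ∀ s, 0 < s → (∀ x, Real.exp (-p) * G 0 ≤ G x → L x < s) →
        ∫⁻ x, ENNReal.ofReal (|L x| ^ p) ∂μ ≤ ENNReal.ofReal ((16 * s) ^ p) := by
  have hp0 : 0 ≤ p := by linarith
  have hint : ∫⁻ x, ENNReal.ofReal (G x) = 1 := by
    rw [← setLIntegral_univ, ← withDensity_apply _ MeasurableSet.univ, ← hμ, measure_univ]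
  have heven : ∀ᵐ x, G (-x) = G x := by
    have := ae_even_of_map_neg (hG.aemeasurable h0).ennreal_ofReal (by simp [hint])
      (by rwa [← hμ])
    filter_upwards [this] with x hx
    exact (ENNReal.ofReal_eq_ofReal_iff (h0 _) (h0 _)).1 hx
  have hmax := ae_le_zero_of_even hG h0 heven
  have hpos := zero_pos_of_lintegral_ne_zero (by simp [hint]) hmax
  have htail : ∀ x, Real.exp (-p) * G 0 ≤ G x →
      ENNReal.ofReal (Real.exp (-(p / 2)) * (1 / 2)) ≤
        ENNReal.ofReal (2 ^ n) * μ {y | L x / 2 ≤ L y} := by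
    intro x hx
    refine le_trans ?_ (hμ ▸ measure_halfspace_ge hG h0 hmax hx)
    rw [ENNReal.ofReal_mul (Real.exp_pos _).le]
    gcongr
    refine le_trans (le_of_eq ?_) (half_le_measure_nonneg hsymm L)
    rw [ENNReal.ofReal_div_of_pos (by norm_num)]
    simp
  have h2n : ENNReal.ofReal (2 ^ n) ≠ 0 := by simp
  refine ⟨hpos, ?_, ?_, ?_⟩
  · obtain ⟨t, ht⟩ := exists_measure_halfspace_lt (μ := μ) L
      (ε := ENNReal.ofReal (Real.exp (-(p / 2)) * (1 / 2)) / ENNReal.ofReal (2 ^ n))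
      (ENNReal.div_pos (by simpa using Real.exp_pos _) ENNReal.ofReal_ne_top)
    refine ⟨2 * t, ?_⟩
    rintro _ ⟨x, hx, rfl⟩
    by_contra! hlt
    have h1 : μ {y | L x / 2 ≤ L y} ≤ μ {y | t ≤ L y} := by
      refine measure_mono fun y (hy : L x / 2 ≤ L y) => ?_
      change t ≤ L y
      linarith
    refine (htail x hx).not_gt ?_
    rw [mul_comm]
    exact (ENNReal.lt_div_iff_mul_lt (Or.inl h2n) (Or.inl ENNReal.ofReal_ne_top)).1
      (h1.trans_lt ht)
  · intro x hLx hx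
    have hmark : ENNReal.ofReal ((L x / 2) ^ p) * μ {y | L x / 2 ≤ L y} ≤
        ∫⁻ x, ENNReal.ofReal (|L x| ^ p) ∂μ := by
      refine le_trans ?_ (mul_meas_ge_le_lintegral₀ (by fun_prop) (ENNReal.ofReal ((L x / 2) ^ p)))
      gcongr with y
      intro hy
      exact ENNReal.ofReal_le_ofReal
        (Real.rpow_le_rpow (by positivity) (hy.trans (le_abs_self _)) hp0)
    refine le_trans ?_ hmark
    refine (ENNReal.mul_le_mul_iff_right h2n ENNReal.ofReal_ne_top).1 ?_
    rw [mul_left_comm]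
    refine le_trans ?_ (mul_le_mul_right (htail x hx) _)
    rw [← ENNReal.ofReal_mul (by positivity), ← ENNReal.ofReal_mul (by positivity)]
    refine ENNReal.ofReal_le_ofReal ?_
    have h4 : (2 : ℝ) ^ n ≤ 2 ^ p := by
      rw [← Real.rpow_natCast]; exact Real.rpow_le_rpow_of_exponent_le (by norm_num) hnp
    have h5 : (1 / 2 : ℝ) ^ p ≤ 1 / 2 := by
      simpa using Real.rpow_le_rpow_of_exponent_ge (x := 1 / 2) (by norm_num) (by norm_num) hp
    have h6 : (1 / 2 : ℝ) ^ p ≤ Real.exp (-(p / 2)) := by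
      rw [Real.rpow_def_of_pos (by norm_num), one_div, Real.log_inv]
      refine Real.exp_le_exp.2 ?_
      have := Real.log_two_gt_d9
      nlinarith
    have hu : 0 ≤ (L x / 2) ^ p := by positivity
    -- The three extra halvings pay for `2 ^ n`, for `e^{-p/2}` (as `log 2 > 1/2`) and for the mass
    -- `1/2` (as `p ≥ 1`).
    have h7 : L x / 16 = L x / 2 * (1 / 2) * (1 / 2) * (1 / 2) := by ring
    have h8 : (2 : ℝ) ^ p * (1 / 2) ^ p = 1 := by
      rw [← Real.mul_rpow (by norm_num) (by norm_num)]; norm_num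
    rw [h7, Real.mul_rpow (by positivity) (by norm_num), Real.mul_rpow (by positivity)
      (by norm_num), Real.mul_rpow (by positivity) (by norm_num)]
    calc 2 ^ n * ((L x / 2) ^ p * (1 / 2) ^ p * (1 / 2) ^ p * (1 / 2) ^ p)
        ≤ 2 ^ p * ((L x / 2) ^ p * (1 / 2) ^ p * (1 / 2) ^ p * (1 / 2) ^ p) := by gcongr
      _ = (2 ^ p * (1 / 2) ^ p) * ((L x / 2) ^ p * ((1 / 2) ^ p * (1 / 2) ^ p)) := by ring
      _ = (L x / 2) ^ p * ((1 / 2) ^ p * (1 / 2) ^ p) := by rw [h8, one_mul]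
      _ ≤ (L x / 2) ^ p * (Real.exp (-(p / 2)) * (1 / 2)) := by gcongr
  · intro s hs hK
    rw [hμ]
    exact lintegral_rpow_le hG h0 hint heven hpos hp hnp hs hK

end Symmetric

/-! ### Transfer to the random vector -/

theorem mem_levelSet_iff {n : ℕ} {g : (Fin n → ℝ) → ENNReal} (hg : ∀ x, g x ≠ ⊤) {p : ℝ}
    {x : Fin n → ℝ} :
    x ∈ levelSet g p ↔ Real.exp (-p) * (g 0).toReal ≤ (g x).toReal := by
  change ENNReal.ofReal (Real.exp (-p)) * g 0 ≤ g x ↔ _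
  rw [← ENNReal.toReal_le_toReal (ENNReal.mul_ne_top ENNReal.ofReal_ne_top (hg 0)) (hg x),
    ENNReal.toReal_mul, ENNReal.toReal_ofReal (Real.exp_pos _).le]

theorem mainTheorem3 :
    ∃ C : ℝ, 0 < C ∧
      ∀ (n : ℕ) (Ω : Type*) [MeasurableSpace Ω] (P : Measure Ω) [IsProbabilityMeasure P]
        (X : Ω → Fin n → ℝ) (g : (Fin n → ℝ) → ENNReal),
        AEMeasurable X P →
        -- `X` has the log-concave density `g`
        IsLogConcave g →
        P.map X = volume.withDensity g →
        -- `X` is symmetric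
        P.map (fun ω => -X ω) = P.map X →
        ∀ (p : ℝ), 0 < p → (n : ℝ) ≤ p → ∀ a : Fin n → ℝ,
          -- both quantities are finite
          Integrable (fun ω => |∑ i, a i * X ω i| ^ p) P ∧
          BddAbove (linearValues a (levelSet g p)) ∧
          -- and they are comparable
          (1 / C) * polarNorm a (levelSet g p) ≤ momentNorm P p (fun ω => ∑ i, a i * X ω i) ∧
          momentNorm P p (fun ω => ∑ i, a i * X ω i) ≤ C * polarNorm a (levelSet g p) := by
  refine ⟨16, by norm_num, ?_⟩
  intro n Ω _ P _ X g hX hg hlaw hsymm p hp hnp a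
  -- Dimension zero is separate: there `p` may be below `1`, but both quantities vanish.
  rcases n.eq_zero_or_pos with rfl | hn
  · have hval : linearValues a (levelSet g p) ⊆ {0} := by
      rintro _ ⟨x, -, rfl⟩
      simp
    have hpolar : polarNorm a (levelSet g p) = 0 := by
      rcases Set.subset_singleton_iff_eq.1 hval with h | h <;> simp [polarNorm, h]
    have hmom : momentNorm P p (fun ω => ∑ i, a i * X ω i) = 0 := by
      simp [momentNorm, Real.zero_rpow hp.ne', hp.ne']
    exact ⟨by simp, bddAbove_singleton.mono hval, by rw [hpolar, hmom, mul_zero],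
      by rw [hpolar, hmom, mul_zero]⟩
  have hp1 : 1 ≤ p := le_trans (by exact_mod_cast hn) hnp
  set L : (Fin n → ℝ) →L[ℝ] ℝ := ∑ i, a i • ContinuousLinearMap.proj i with hL
  have hLx : ∀ x, ∑ i, a i * x i = L x := fun x => by simp [hL]
  have hset : levelSet g p = {x | Real.exp (-p) * (g 0).toReal ≤ (g x).toReal} :=
    Set.ext fun x => mem_levelSet_iff hg.ne_top
  have : IsProbabilityMeasure (P.map X) := Measure.isProbabilityMeasure_map hX
  have hsymm' : (P.map X).map (fun x => -x) = P.map X := by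
    rw [AEMeasurable.map_map_of_aemeasurable measurable_neg.aemeasurable hX]
    exact hsymm
  obtain ⟨hpos, hbdd, hlow, hupp⟩ := moment_bounds hg.isMulConcave
    (fun x => ENNReal.toReal_nonneg) (μ := P.map X)
    (by simp only [ENNReal.ofReal_toReal (hg.ne_top _), hlaw]) hsymm' L hp1 hnp
  have hint : ∫⁻ x, ENNReal.ofReal (|L x| ^ p) ∂P.map X = ∫⁻ ω, ENNReal.ofReal (|L (X ω)| ^ p) ∂P :=
    lintegral_map' (by fun_prop) hX
  rw [hint] at hlow hupp
  have himage : linearValues a (levelSet g p) =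
      L '' {x | Real.exp (-p) * (g 0).toReal ≤ (g x).toReal} := by
    simp only [linearValues, hLx, hset]
  have hle : ∀ x, Real.exp (-p) * (g 0).toReal ≤ (g x).toReal →
      L x ≤ polarNorm a (levelSet g p) := fun x hx => by
    rw [polarNorm, himage]
    exact le_csSup hbdd ⟨x, hx, rfl⟩
  have h0mem : Real.exp (-p) * (g 0).toReal ≤ (g 0).toReal :=
    mul_le_of_le_one_left hpos.le (Real.exp_le_one_iff.2 (by linarith))
  have hS0 : 0 ≤ polarNorm a (levelSet g p) := by simpa using hle 0 h0mem
  have hmeas : AEStronglyMeasurable (fun ω => |L (X ω)| ^ p) P :=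
    ((by fun_prop : Measurable fun x => |L x| ^ p).comp_aemeasurable hX).aestronglyMeasurable
  have hnonneg : ∀ ω, 0 ≤ |L (X ω)| ^ p := fun ω => by positivity
  have hfin : ∫⁻ ω, ENNReal.ofReal (|L (X ω)| ^ p) ∂P < ⊤ :=
    (hupp (polarNorm a (levelSet g p) + 1) (by linarith)
      fun x hx => by linarith [hle x hx]).trans_lt ENNReal.ofReal_lt_top
  have hI : Integrable (fun ω => |L (X ω)| ^ p) P :=
    ⟨hmeas, (hasFiniteIntegral_iff_ofReal (Filter.Eventually.of_forall hnonneg)).2 hfin⟩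
  have hI0 : 0 ≤ ∫ ω, |L (X ω)| ^ p ∂P := integral_nonneg hnonneg
  rw [← ofReal_integral_eq_lintegral_ofReal hI (Filter.Eventually.of_forall hnonneg)] at hlow hupp
  simp only [momentNorm, hLx, one_div]
  refine ⟨hI, himage ▸ hbdd, ?_, ?_⟩
  · have hmom0 : 0 ≤ (∫ ω, |L (X ω)| ^ p ∂P) ^ p⁻¹ := by positivity
    rw [inv_mul_le_iff₀ (by norm_num)]
    refine csSup_le ?_ ?_
    · exact himage ▸ ⟨_, 0, h0mem, rfl⟩
    rw [himage]
    rintro _ ⟨x, hx, rfl⟩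
    rcases le_total (L x) 0 with h | h
    · exact h.trans (by positivity)
    have := (ENNReal.ofReal_le_ofReal_iff hI0).1 (hlow x h hx)
    have := (Real.le_rpow_inv_iff_of_pos (by positivity) hI0 hp).2 this
    linarith
  -- The upper bound needs a strict, positive `s`, and the polar norm may be attained or zero; hence
  -- the slack `ε / 16`.
  · refine le_of_forall_pos_le_add fun ε hε => ?_
    have := hupp (polarNorm a (levelSet g p) + ε / 16) (by linarith)
      fun x hx => by linarith [hle x hx]
    rw [ENNReal.ofReal_le_ofReal_iff (by positivity)] at this
    have := (Real.rpow_inv_le_iff_of_pos hI0 (by positivity) hp).2 this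
    linarith
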